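/- Energy shocks arrive at the times $0<t_1<t_2<\dots$ of a Poisson process of rate $Q>0$; their sizes $W_1,W_2,\dots$ are i.i.d. copies of a random variable $W$ with values in $[0,B]$, independent of the arrival times. A storage of capacity $\bar s<\infty$ is refilled at rate $r>0$ while it is not full. A (stationary Markov) policy is a measurable map $\mu$ with $0\le\mu(s,w)\le\min\{s,w\}$ on $[0,\bar s]\times[0,B]$: if a shock of size $w$ finds the storage level $s$, the energy $\mu(s,w)$ is withdrawn, so that $$s_t=s_0+\int_0^t \mathbb I_{\{s_\tau<\bar s\}}\,r\,d\tau-\sum_{k:\,t_k\le t}\mu(s_{t_k^-},W_k).$$ Let $\theta>0$, and let the stage cost $g:[0,B]\to\mathbb R$ be strictly increasing, continuously differentiable and strictly convex, with $g(0)=0$ and $\mathbf E[g(W)]>0$. Put $$C_\mu(s)=\mathbf E\Big[\sum_{k\ge1}e^{-\theta t_k}\,g\big(W_k-\mu(s_{t_k^-},W_k)\big)\,\Big|\,s_0=s\Big],\qquad J_\mu(s,w)=g\big(w-\mu(s,w)\big)+C_\mu\big(s-\mu(s,w)\big),$$ so that $J_\mu(s,w)$ is the expected discounted cost when a shock of size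 $w$ at time $0$ finds the level $s$. Let $\mu^*$ be an optimal policy, that is, a policy which minimizes $C_\mu(s)$ over all policies $\mu$ for every $s\in[0,\bar s]$, and also $J_\mu(s,w)$ for every $(s,w)\in[0,\bar s]\times[0,B]$. If the storage process has positive drift in the sense that $Q\,\mathbf E[W]\le r$, then $\mu^*(s,w)$ is nondecreasing in $s\in[0,\bar s]$ for every $w\in[0,B]$, and nondecreasing in $w\in[0,B]$ for every $s\in[0,\bar s]$. -/

import Mathlib

open MeasureTheory ProbabilityTheory Set

noncomputable section

/-- The data of the controlled storage system. -/
structure StorageModel where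
  /-- arrival rate `Q` of the compound Poisson process of energy shocks -/
  rate : ℝ
  /-- discount rate `θ` -/
  discount : ℝ
  /-- upward ramp constraint `r` of the storage -/
  ramp : ℝ
  /-- storage capacity -/
  cap : ℝ
  /-- upper bound `B` on the size of a shock -/
  maxShock : ℝ
  /-- distribution of the size `W` of a shock -/
  shockLaw : Measure ℝ
  /-- stage cost `g`; only its values on `[0, B]` matter -/
  cost : ℝ → ℝ

namespace StorageModel

/-- The standing assumptions on the model. (Boundedness of the stage cost on `[0, B]` is implied
by its continuity.) -/
structure IsAdmissible (M : StorageModel) : Prop where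
  rate_pos : 0 < M.rate
  discount_pos : 0 < M.discount
  ramp_pos : 0 < M.ramp
  cap_nonneg : 0 ≤ M.cap
  isProbabilityMeasure : IsProbabilityMeasure M.shockLaw
  shockLaw_support : M.shockLaw (Icc 0 M.maxShock)ᶜ = 0
  cost_strictMonoOn : StrictMonoOn M.cost (Icc 0 M.maxShock)
  cost_contDiffOn : ContDiffOn ℝ 1 M.cost (Icc 0 M.maxShock)
  cost_zero : M.cost 0 = 0
  cost_mean_pos : 0 < ∫ w, M.cost w ∂M.shockLaw

/-- Positive drift: `Q · E[W] ≤ r`. -/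
def PositiveDrift (M : StorageModel) : Prop :=
  M.rate * ∫ w, w ∂M.shockLaw ≤ M.ramp

/-- The law of the marked Poisson process of shocks. In a sample `ω : ℕ → ℝ × ℝ`, `(ω k).1` is the
time elapsed between the `k`-th shock and the one before it (the initial time if `k = 0`), and
`(ω k).2` is the size of the `k`-th shock. All these variables are independent, the waiting times
are exponential with rate `Q`, and the sizes have law `shockLaw`. -/
def pathLaw (M : StorageModel) : Measure (ℕ → ℝ × ℝ) :=
  Measure.infinitePi fun _ : ℕ => (expMeasure M.rate).prod M.shockLaw

/-- Arrival time of the `k`-th shock, shocks being numbered from `0`. -/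
def arrivalTime (ω : ℕ → ℝ × ℝ) (k : ℕ) : ℝ :=
  ∑ i ∈ Finset.range (k + 1), (ω i).1

/-- Storage level after a time `t` without shocks, starting from the level `s`. -/
def refill (M : StorageModel) (s t : ℝ) : ℝ :=
  min (s + M.ramp * t) M.cap

/-- `refill` is the solution of the storage dynamics between shocks. -/
theorem refill_eq_integral (M : StorageModel) (hr : 0 < M.ramp) {s t : ℝ} (hs : s ≤ M.cap)
    (ht : 0 ≤ t) :
    M.refill s t = s + ∫ τ in (0 : ℝ)..t, {τ | M.refill s τ < M.cap}.indicator
      (fun _ => M.ramp) τ := by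
  have hset : {τ | M.refill s τ < M.cap} = Iio ((M.cap - s) / M.ramp) := by
    ext τ
    simp only [refill, mem_ofPred_eq, mem_Iio, min_lt_iff, lt_irrefl, or_false, lt_div_iff₀ hr]
    constructor <;> intro h <;> linarith [mul_comm τ M.ramp]
  have hinter : (Ioc 0 t ∩ Iio ((M.cap - s) / M.ramp) : Set ℝ) =ᵐ[volume]
      (Ioc 0 (min t ((M.cap - s) / M.ramp)) : Set ℝ) := by
    have h : (Iio ((M.cap - s) / M.ramp) : Set ℝ) =ᵐ[volume] Iic ((M.cap - s) / M.ramp) :=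
      Iio_ae_eq_Iic
    have h' := (ae_eq_refl (μ := volume) (Ioc 0 t)).inter h
    rwa [Ioc_inter_Iic] at h'
  rw [hset, intervalIntegral.integral_of_le ht, integral_indicator measurableSet_Iio,
    Measure.restrict_restrict measurableSet_Iio, inter_comm, setIntegral_congr_set hinter,
    setIntegral_const, refill]
  have h0 : 0 ≤ (M.cap - s) / M.ramp := div_nonneg (by linarith) hr.le
  simp only [Real.volume_real_Ioc, sub_zero, smul_eq_mul]
  rw [max_eq_left (le_min ht h0)]
  rcases le_total t ((M.cap - s) / M.ramp) with h | h
  · rw [min_eq_left h]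
    rw [le_div_iff₀ hr] at h
    rw [min_eq_left (by linarith [mul_comm t M.ramp])]
    ring
  · rw [min_eq_right h]
    rw [div_mul_cancel₀ _ hr.ne']
    rw [div_le_iff₀ hr] at h
    rw [min_eq_right (by linarith [mul_comm t M.ramp])]
    ring

/-- Storage level immediately before the `k`-th shock, when the initial level is `s` and the
policy `μ` is applied: at a shock of size `w` that finds the level `x`, the energy `μ x w` is
withdrawn. -/
def levelBefore (M : StorageModel) (μ : ℝ → ℝ → ℝ) (s : ℝ) (ω : ℕ → ℝ × ℝ) : ℕ → ℝ
  | 0 => M.refill s (ω 0).1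
  | k + 1 =>
    M.refill (levelBefore M μ s ω k - μ (levelBefore M μ s ω k) (ω k).2) (ω (k + 1)).1

/-- `C_μ(s)`: expected discounted cost of blackouts of the policy `μ` from the initial
level `s`. -/
def expectedCost (M : StorageModel) (μ : ℝ → ℝ → ℝ) (s : ℝ) : ℝ :=
  ∫ ω, ∑' k : ℕ, Real.exp (-M.discount * arrivalTime ω k) *
    M.cost ((ω k).2 - μ (M.levelBefore μ s ω k) (ω k).2) ∂M.pathLaw

/-- `J_μ(s, w)`: expected discounted cost of the policy `μ` when a shock of size `w` occurs at
time `0` and finds the storage level `s`. -/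
def costAtShock (M : StorageModel) (μ : ℝ → ℝ → ℝ) (s w : ℝ) : ℝ :=
  M.cost (w - μ s w) + M.expectedCost μ (s - μ s w)

/-- The set `Π` of feasible stationary Markov policies. Only the values of `μ` on
`[0, cap] × [0, B]` matter. -/
structure IsPolicy (M : StorageModel) (μ : ℝ → ℝ → ℝ) : Prop where
  measurable : Measurable (Function.uncurry μ)
  mem_Icc : ∀ s ∈ Icc 0 M.cap, ∀ w ∈ Icc 0 M.maxShock, μ s w ∈ Icc 0 (min s w)

/-- `μ` is an optimal policy: among all policies it minimizes the expected cost from every initial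
level, and also the expected cost given an initial shock, for every level and every size of this
shock. The second property implies the first one; the first one alone would leave `μ` arbitrary on
sets of pairs `(s, w)` which are almost surely never met. -/
structure IsOptimalPolicy (M : StorageModel) (μ : ℝ → ℝ → ℝ) : Prop where
  isPolicy : M.IsPolicy μ
  expectedCost_le : ∀ μ', M.IsPolicy μ' → ∀ s ∈ Icc 0 M.cap,
    M.expectedCost μ s ≤ M.expectedCost μ' s
  costAtShock_le : ∀ μ', M.IsPolicy μ' → ∀ s ∈ Icc 0 M.cap, ∀ w ∈ Icc 0 M.maxShock,
    M.costAtShock μ s w ≤ M.costAtShock μ' s w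

end StorageModel

end

noncomputable section

/-! The argument is dynamic programming followed by an exchange. With `V` the fixed point of the
Bellman operator (`value`), withdrawing `u` at `(s, w)` costs `g (w - u) + V (s - u)`. The Bellman
operator preserves functions that are antitone and convex on `[0, cap]`, so `V` is both
(`value_antitone_convexOn`). As `g` is strictly convex, the one-step problem has a unique minimizer
(`minimizer_unique`).

By compactness this minimizer depends continuously on `(s, w)`, hence is a policy `ν`
(`exists_greedy_policy`). Conditioning on the first shock (`expectedCost_renewal`) shows that `V` is
a lower bound for the cost of every policy and an upper bound for the cost of `ν`. Comparing an
optimal `μ` with `ν` at a shock shows that `μ s w` is the minimizer at every pair, not merely almost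
everywhere (`IsOptimalPolicy.withdrawCost_le`).

Suppose now that `s ≤ s'` but `u = μ s w > u' = μ s' w`. The levels `s - u'` and `s' - u` lie
between `s - u` and `s' - u'` and have the same sum, so by convexity of `V` swapping the two
withdrawals does not raise the total cost. Hence `u'` is a second minimizer at `(s, w)`,
contradicting uniqueness. For monotonicity in `w` the same exchange uses convexity of `g`. -/

/-- If `y` and `z` lie between `x` and `v` and have the same sum, a convex function has a smaller
sum at `y`, `z` than at `x`, `v`. -/
theorem ConvexOn.add_le_add_of_add_eq {I : Set ℝ} {f : ℝ → ℝ} (hf : ConvexOn ℝ I f) {x y z v : ℝ}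
    (hx : x ∈ I) (hv : v ∈ I) (hxy : x ≤ y) (hxz : x ≤ z) (h : y + z = x + v) :
    f y + f z ≤ f x + f v := by
  rcases eq_or_lt_of_le (show x ≤ v by linarith) with rfl | hlt
  · have h1 : y = x := by linarith
    have h2 : z = x := by linarith
    rw [h1, h2]
  · have hd : 0 < v - x := by linarith
    set t := (y - x) / (v - x) with ht
    have htm : t * (v - x) = y - x := div_mul_cancel₀ _ hd.ne'
    have ht0 : 0 ≤ t := div_nonneg (by linarith) hd.le
    have ht1 : 0 ≤ 1 - t := by
      rw [sub_nonneg, ht, div_le_one hd]; linarith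
    have e1 := hf.2 hx hv ht1 ht0 (by ring)
    have e2 := hf.2 hx hv ht0 ht1 (by ring)
    simp only [smul_eq_mul] at e1 e2
    rw [show (1 - t) * x + t * v = y by linarith] at e1
    rw [show t * x + (1 - t) * v = z by linarith] at e2
    linarith

namespace StorageModel

open scoped BoundedContinuousFunction

/-! ### Splitting the path law at the first shock -/

/-- The path with first step `p.1` and remaining steps `p.2`. -/
def consPath (p : (ℝ × ℝ) × (ℕ → ℝ × ℝ)) : ℕ → ℝ × ℝ
  | 0 => p.1
  | k + 1 => p.2 k

theorem measurable_consPath : Measurable consPath := by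
  refine measurable_pi_lambda _ fun k => ?_
  cases k with
  | zero => exact measurable_fst
  | succ k => exact (measurable_pi_apply k).comp measurable_snd

/-- The law of a waiting time together with the size of the shock that ends it. -/
def stepLaw (M : StorageModel) : Measure (ℝ × ℝ) :=
  (expMeasure M.rate).prod M.shockLaw

theorem isProbabilityMeasure_stepLaw {M : StorageModel} (hM : M.IsAdmissible) :
    IsProbabilityMeasure M.stepLaw := by
  have := isProbabilityMeasure_expMeasure hM.rate_pos
  have := hM.isProbabilityMeasure
  unfold stepLaw
  infer_instance

theorem isProbabilityMeasure_pathLaw {M : StorageModel} (hM : M.IsAdmissible) :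
    IsProbabilityMeasure M.pathLaw := by
  have := isProbabilityMeasure_stepLaw hM
  change IsProbabilityMeasure (Measure.infinitePi fun _ : ℕ => M.stepLaw)
  infer_instance

/-- An infinite product measure is determined by its values on finite boxes, and on these prepending
an independent step only adds one factor. -/
theorem map_consPath {M : StorageModel} (hM : M.IsAdmissible) :
    (M.stepLaw.prod M.pathLaw).map consPath = M.pathLaw := by
  have := isProbabilityMeasure_stepLaw hM
  have := isProbabilityMeasure_pathLaw hM
  refine Measure.eq_infinitePi (μ := fun _ : ℕ => M.stepLaw) fun s t ht => ?_
  set n := s.sup id + 1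
  have hsub : s ⊆ Finset.range (n + 1) := fun i hi => by
    have := Finset.le_sup (f := id) hi
    simp only [id] at this
    simp only [Finset.mem_range]; omega
  classical
  -- Padding with `univ` turns the box into one over an initial segment, which splits into index `0`
  -- and a shifted segment.
  set t' : ℕ → Set (ℝ × ℝ) := fun i => if i ∈ s then t i else univ with ht'
  have mt' : ∀ i, MeasurableSet (t' i) := fun i => by
    simp only [ht']; split_ifs
    · exact ht i
    · exact MeasurableSet.univ
  have h1 : (s : Set ℕ).pi t = (Finset.range (n + 1) : Set ℕ).pi t' := by
    ext x
    simp only [Set.mem_pi, ht']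
    constructor
    · intro h i _
      split_ifs with hi
      · exact h i hi
      · trivial
    · intro h i hi
      have := h i (hsub hi)
      rwa [if_pos (by exact hi)] at this
  have h2 : ∏ i ∈ s, M.stepLaw (t i) = ∏ i ∈ Finset.range (n + 1), M.stepLaw (t' i) := by
    rw [← Finset.prod_subset hsub]
    · exact Finset.prod_congr rfl fun i hi => by simp [ht', hi]
    · intro i _ hi
      simp [ht', hi]
  have h3 : consPath ⁻¹' ((Finset.range (n + 1) : Set ℕ).pi t') =
      t' 0 ×ˢ ((Finset.range n : Set ℕ).pi fun i => t' (i + 1)) := by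
    ext ⟨a, ω⟩
    simp only [mem_preimage, Set.mem_pi, mem_prod, Finset.coe_range, mem_Iio]
    constructor
    · exact fun h => ⟨h 0 (by omega), fun i hi => h (i + 1) (by omega)⟩
    · rintro ⟨h0, h⟩ i hi
      cases i with
      | zero => exact h0
      | succ i => exact h i (by omega)
  have mp : MeasurableSet ((Finset.range (n + 1) : Set ℕ).pi t') :=
    MeasurableSet.pi (Finset.countable_toSet _) fun i _ => mt' i
  rw [h1, h2, Measure.map_apply measurable_consPath mp, h3, Measure.prod_prod,
    Finset.prod_range_succ', mul_comm]
  congr 1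
  exact Measure.infinitePi_pi (fun _ : ℕ => M.stepLaw) fun i _ => mt' (i + 1)

theorem ae_stepLaw {M : StorageModel} (hM : M.IsAdmissible) :
    ∀ᵐ a ∂M.stepLaw, 0 < a.1 ∧ a.2 ∈ Icc 0 M.maxShock := by
  have := isProbabilityMeasure_expMeasure hM.rate_pos
  have := hM.isProbabilityMeasure
  have h1 : ∀ᵐ t ∂expMeasure M.rate, 0 < t := by
    have hac : expMeasure M.rate ≪ volume := withDensity_absolutelyContinuous _ _
    have hne : ∀ᵐ t ∂expMeasure M.rate, t ≠ 0 := hac.ae_le (Measure.ae_ne volume 0)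
    have hnn : ∀ᵐ t ∂expMeasure M.rate, 0 ≤ t := by
      have : expMeasure M.rate (Iio 0) = 0 := by
        rw [expMeasure, gammaMeasure, withDensity_apply _ measurableSet_Iio]
        exact lintegral_gammaPDF_of_nonpos le_rfl
      rw [ae_iff]
      simpa [Iio] using this
    filter_upwards [hne, hnn] with t h h' using lt_of_le_of_ne h' h.symm
  have h2 : ∀ᵐ w ∂M.shockLaw, w ∈ Icc 0 M.maxShock := hM.shockLaw_support
  have q1 : ∀ᵐ a ∂M.stepLaw, 0 < a.1 := Measure.quasiMeasurePreserving_fst.ae h1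
  have q2 : ∀ᵐ a ∂M.stepLaw, a.2 ∈ Icc 0 M.maxShock := Measure.quasiMeasurePreserving_snd.ae h2
  exact q1.and q2

theorem ae_pathLaw_step {M : StorageModel} (hM : M.IsAdmissible) :
    ∀ᵐ ω ∂M.pathLaw, ∀ k, 0 < (ω k).1 ∧ (ω k).2 ∈ Icc 0 M.maxShock := by
  have := isProbabilityMeasure_stepLaw hM
  rw [ae_all_iff]
  intro k
  exact (measurePreserving_eval_infinitePi (fun _ : ℕ => M.stepLaw) k).quasiMeasurePreserving.ae
    (ae_stepLaw hM)

theorem maxShock_nonneg {M : StorageModel} (hM : M.IsAdmissible) : 0 ≤ M.maxShock := by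
  have := isProbabilityMeasure_stepLaw hM
  obtain ⟨a, -, h⟩ := (ae_stepLaw hM).exists
  exact h.1.trans h.2

theorem lintegral_pathLaw {M : StorageModel} (hM : M.IsAdmissible)
    {f : (ℕ → ℝ × ℝ) → ENNReal} (hf : Measurable f) :
    ∫⁻ ω, f ω ∂M.pathLaw = ∫⁻ a, ∫⁻ ω, f (consPath (a, ω)) ∂M.pathLaw ∂M.stepLaw := by
  have := isProbabilityMeasure_stepLaw hM
  have := isProbabilityMeasure_pathLaw hM
  conv_lhs => rw [← map_consPath hM]
  rw [lintegral_map hf measurable_consPath]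
  exact lintegral_prod (fun p => f (consPath p)) (hf.comp measurable_consPath).aemeasurable

theorem arrivalTime_consPath_zero (a : ℝ × ℝ) (ω : ℕ → ℝ × ℝ) :
    arrivalTime (consPath (a, ω)) 0 = a.1 := by
  simp [arrivalTime, consPath]

theorem arrivalTime_consPath_succ (a : ℝ × ℝ) (ω : ℕ → ℝ × ℝ) (k : ℕ) :
    arrivalTime (consPath (a, ω)) (k + 1) = a.1 + arrivalTime ω k := by
  rw [arrivalTime, Finset.sum_range_succ', add_comm]
  rfl

theorem levelBefore_consPath_succ (M : StorageModel) (μ : ℝ → ℝ → ℝ) (s : ℝ) (a : ℝ × ℝ)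
    (ω : ℕ → ℝ × ℝ) (k : ℕ) :
    M.levelBefore μ s (consPath (a, ω)) (k + 1) =
      M.levelBefore μ (M.refill s a.1 - μ (M.refill s a.1) a.2) ω k := by
  induction k with
  | zero => rfl
  | succ k ih =>
    rw [levelBefore, ih]
    rfl

@[fun_prop]
theorem measurable_arrivalTime (k : ℕ) : Measurable fun ω => arrivalTime ω k := by
  unfold arrivalTime
  fun_prop

/-! ### Summability of the discount factors -/

/-- The expected discount factor at the first shock. -/
def meanDiscount (M : StorageModel) : ENNReal :=
  ∫⁻ a, ENNReal.ofReal (Real.exp (-M.discount * a.1)) ∂M.stepLaw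

theorem meanDiscount_lt_one {M : StorageModel} (hM : M.IsAdmissible) : M.meanDiscount < 1 := by
  have := isProbabilityMeasure_stepLaw hM
  have hlt : ∀ᵐ a ∂M.stepLaw, ENNReal.ofReal (Real.exp (-M.discount * a.1)) < 1 := by
    filter_upwards [ae_stepLaw hM] with a ha
    rw [ENNReal.ofReal_lt_one, Real.exp_lt_one_iff]
    nlinarith [mul_pos hM.discount_pos ha.1]
  have hfin : ∫⁻ a, ENNReal.ofReal (Real.exp (-M.discount * a.1)) ∂M.stepLaw ≠ ⊤ := by
    refine ((lintegral_mono_ae (hlt.mono fun a h => h.le)).trans_lt ?_).ne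
    simp
  have := lintegral_strict_mono (NeZero.ne _) aemeasurable_const hfin hlt
  simpa [meanDiscount] using this

/-- The waiting times are independent. The exponent is `k + 1` because shocks are numbered from `0`.
-/
theorem lintegral_exp_arrivalTime {M : StorageModel} (hM : M.IsAdmissible) (k : ℕ) :
    ∫⁻ ω, ENNReal.ofReal (Real.exp (-M.discount * arrivalTime ω k)) ∂M.pathLaw =
      M.meanDiscount ^ (k + 1) := by
  have := isProbabilityMeasure_pathLaw hM
  induction k with
  | zero =>
    rw [lintegral_pathLaw hM (by fun_prop)]
    simp [arrivalTime_consPath_zero, meanDiscount]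
  | succ k ih =>
    rw [lintegral_pathLaw hM (by fun_prop)]
    simp_rw [arrivalTime_consPath_succ, mul_add, Real.exp_add,
      ENNReal.ofReal_mul (Real.exp_pos _).le]
    rw [pow_succ', ← ih, meanDiscount, ← lintegral_mul_const _ (by fun_prop)]
    exact lintegral_congr fun a => lintegral_const_mul _ (by fun_prop)

theorem lintegral_tsum_exp_arrivalTime_ne_top {M : StorageModel} (hM : M.IsAdmissible) :
    ∫⁻ ω, ∑' k, ENNReal.ofReal (Real.exp (-M.discount * arrivalTime ω k)) ∂M.pathLaw ≠ ⊤ := by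
  rw [lintegral_tsum fun k => by fun_prop]
  simp_rw [lintegral_exp_arrivalTime hM]
  rw [ENNReal.tsum_geometric_add_one]
  have h := meanDiscount_lt_one hM
  exact ENNReal.mul_ne_top h.ne_top (ENNReal.inv_ne_top.2 (tsub_pos_of_lt h).ne')

/-- The sample paths for which the discounted cost is well behaved. -/
structure IsRegularPath (M : StorageModel) (ω : ℕ → ℝ × ℝ) : Prop where
  time_pos : ∀ k, 0 < (ω k).1
  shock_mem : ∀ k, (ω k).2 ∈ Icc 0 M.maxShock
  summable : Summable fun k => Real.exp (-M.discount * arrivalTime ω k)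

theorem ae_isRegularPath {M : StorageModel} (hM : M.IsAdmissible) :
    ∀ᵐ ω ∂M.pathLaw, M.IsRegularPath ω := by
  have h := ae_lt_top (by fun_prop) (lintegral_tsum_exp_arrivalTime_ne_top hM)
  filter_upwards [h, ae_pathLaw_step hM] with ω h1 h2
  refine ⟨fun k => (h2 k).1, fun k => (h2 k).2, ?_⟩
  have := ENNReal.summable_toReal h1.ne
  simpa [ENNReal.toReal_ofReal (Real.exp_pos _).le] using this

theorem integrable_tsum_exp_arrivalTime {M : StorageModel} (hM : M.IsAdmissible) :
    Integrable (fun ω => ∑' k, Real.exp (-M.discount * arrivalTime ω k)) M.pathLaw := by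
  have h := integrable_toReal_of_lintegral_ne_top
    (Measurable.aemeasurable (by fun_prop)) (lintegral_tsum_exp_arrivalTime_ne_top hM)
  refine h.congr (ae_of_all _ fun ω => ?_)
  beta_reduce
  rw [ENNReal.tsum_toReal_eq fun k => ENNReal.ofReal_ne_top]
  simp [ENNReal.toReal_ofReal (Real.exp_pos _).le]

theorem IsRegularPath.consPath {M : StorageModel} {ω : ℕ → ℝ × ℝ} (h : M.IsRegularPath ω)
    {a : ℝ × ℝ} (ha : 0 < a.1 ∧ a.2 ∈ Icc 0 M.maxShock) :
    M.IsRegularPath (consPath (a, ω)) := by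
  refine ⟨fun k => ?_, fun k => ?_, ?_⟩
  · cases k with
    | zero => exact ha.1
    | succ k => exact h.time_pos k
  · cases k with
    | zero => exact ha.2
    | succ k => exact h.shock_mem k
  · rw [← summable_nat_add_iff 1]
    simp_rw [arrivalTime_consPath_succ, mul_add, Real.exp_add]
    exact h.summable.mul_left _

/-! ### Feasibility of the trajectories and integrability of the cost -/

theorem refill_mem {M : StorageModel} (hM : M.IsAdmissible) {s t : ℝ} (hs : 0 ≤ s) (ht : 0 ≤ t) :
    M.refill s t ∈ Icc 0 M.cap :=
  ⟨le_min (add_nonneg hs (mul_nonneg hM.ramp_pos.le ht)) hM.cap_nonneg, min_le_right _ _⟩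

theorem IsPolicy.sub_mem {M : StorageModel} {μ : ℝ → ℝ → ℝ} (hμ : M.IsPolicy μ) {s w : ℝ}
    (hs : s ∈ Icc 0 M.cap) (hw : w ∈ Icc 0 M.maxShock) :
    s - μ s w ∈ Icc 0 M.cap ∧ w - μ s w ∈ Icc 0 M.maxShock := by
  have h := hμ.mem_Icc s hs w hw
  have h1 := h.2.trans (min_le_left _ _)
  have h2 := h.2.trans (min_le_right _ _)
  exact ⟨⟨by linarith, by linarith [h.1, hs.2]⟩, ⟨by linarith, by linarith [h.1, hw.2]⟩⟩

theorem levelBefore_mem {M : StorageModel} (hM : M.IsAdmissible) {μ : ℝ → ℝ → ℝ}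
    (hμ : M.IsPolicy μ) {s : ℝ} (hs : s ∈ Icc 0 M.cap) {ω : ℕ → ℝ × ℝ} (hω : M.IsRegularPath ω)
    (k : ℕ) : M.levelBefore μ s ω k ∈ Icc 0 M.cap := by
  induction k with
  | zero => exact refill_mem hM hs.1 (hω.time_pos 0).le
  | succ k ih =>
    exact refill_mem hM (hμ.sub_mem ih (hω.shock_mem k)).1.1 (hω.time_pos (k + 1)).le

theorem continuous_refill (M : StorageModel) : Continuous fun p : ℝ × ℝ => M.refill p.1 p.2 := by
  unfold refill
  fun_prop

theorem measurable_levelBefore {M : StorageModel} {μ : ℝ → ℝ → ℝ} (hμ : M.IsPolicy μ) (s : ℝ)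
    (k : ℕ) : Measurable fun ω => M.levelBefore μ s ω k := by
  induction k with
  | zero =>
    exact M.continuous_refill.measurable.comp (measurable_const.prodMk (measurable_pi_apply 0).fst)
  | succ k ih =>
    exact M.continuous_refill.measurable.comp ((ih.sub (hμ.measurable.comp
      (ih.prodMk (measurable_pi_apply k).snd))).prodMk (measurable_pi_apply (k + 1)).fst)

/-- The stage cost, extended from `[0, B]` to `ℝ` by constants. -/
def extCost (M : StorageModel) (x : ℝ) : ℝ :=
  M.cost (max 0 (min x M.maxShock))

theorem extCost_of_mem {M : StorageModel} {x : ℝ} (hx : x ∈ Icc 0 M.maxShock) :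
    M.extCost x = M.cost x := by
  rw [extCost, min_eq_left hx.2, max_eq_right hx.1]

theorem continuous_extCost {M : StorageModel} (hM : M.IsAdmissible) : Continuous M.extCost :=
  hM.cost_contDiffOn.continuousOn.comp_continuous (by fun_prop) fun _ =>
    ⟨le_max_left _ _, max_le (maxShock_nonneg hM) (min_le_right _ _)⟩

theorem cost_mem {M : StorageModel} (hM : M.IsAdmissible) {x : ℝ} (hx : x ∈ Icc 0 M.maxShock) :
    M.cost x ∈ Icc 0 (M.cost M.maxShock) := by
  have hB := maxShock_nonneg hM
  have h0 := hM.cost_strictMonoOn.monotoneOn (left_mem_Icc.2 hB) hx hx.1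
  rw [hM.cost_zero] at h0
  exact ⟨h0, hM.cost_strictMonoOn.monotoneOn hx (right_mem_Icc.2 hB) hx.2⟩

theorem extCost_mem {M : StorageModel} (hM : M.IsAdmissible) (x : ℝ) :
    M.extCost x ∈ Icc 0 (M.cost M.maxShock) :=
  cost_mem hM ⟨le_max_left _ _, max_le (maxShock_nonneg hM) (min_le_right _ _)⟩

/-- Discounted cost of the policy `μ` along a sample path. -/
def pathCost (M : StorageModel) (μ : ℝ → ℝ → ℝ) (s : ℝ) (ω : ℕ → ℝ × ℝ) : ℝ :=
  ∑' k : ℕ, Real.exp (-M.discount * arrivalTime ω k) *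
    M.cost ((ω k).2 - μ (M.levelBefore μ s ω k) (ω k).2)

theorem expectedCost_eq (M : StorageModel) (μ : ℝ → ℝ → ℝ) (s : ℝ) :
    M.expectedCost μ s = ∫ ω, M.pathCost μ s ω ∂M.pathLaw := rfl

theorem cost_levelBefore_mem {M : StorageModel} (hM : M.IsAdmissible) {μ : ℝ → ℝ → ℝ}
    (hμ : M.IsPolicy μ) {s : ℝ} (hs : s ∈ Icc 0 M.cap) {ω : ℕ → ℝ × ℝ} (hω : M.IsRegularPath ω)
    (k : ℕ) : M.cost ((ω k).2 - μ (M.levelBefore μ s ω k) (ω k).2) ∈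
      Icc 0 (M.cost M.maxShock) :=
  cost_mem hM (hμ.sub_mem (levelBefore_mem hM hμ hs hω k) (hω.shock_mem k)).2

theorem summable_pathCost {M : StorageModel} (hM : M.IsAdmissible) {μ : ℝ → ℝ → ℝ}
    (hμ : M.IsPolicy μ) {s : ℝ} (hs : s ∈ Icc 0 M.cap) {ω : ℕ → ℝ × ℝ} (hω : M.IsRegularPath ω) :
    Summable fun k => Real.exp (-M.discount * arrivalTime ω k) *
      M.cost ((ω k).2 - μ (M.levelBefore μ s ω k) (ω k).2) :=
  Summable.of_nonneg_of_le
    (fun k => mul_nonneg (Real.exp_pos _).le (cost_levelBefore_mem hM hμ hs hω k).1)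
    (fun k => mul_le_mul_of_nonneg_left (cost_levelBefore_mem hM hμ hs hω k).2 (Real.exp_pos _).le)
    (hω.summable.mul_right _)

theorem pathCost_mem {M : StorageModel} (hM : M.IsAdmissible) {μ : ℝ → ℝ → ℝ}
    (hμ : M.IsPolicy μ) {s : ℝ} (hs : s ∈ Icc 0 M.cap) {ω : ℕ → ℝ × ℝ} (hω : M.IsRegularPath ω) :
    M.pathCost μ s ω ∈ Icc 0 ((∑' k, Real.exp (-M.discount * arrivalTime ω k)) *
      M.cost M.maxShock) := by
  refine ⟨tsum_nonneg fun k =>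
    mul_nonneg (Real.exp_pos _).le (cost_levelBefore_mem hM hμ hs hω k).1, ?_⟩
  rw [← tsum_mul_right]
  exact (summable_pathCost hM hμ hs hω).tsum_le_tsum (fun k =>
    mul_le_mul_of_nonneg_left (cost_levelBefore_mem hM hμ hs hω k).2 (Real.exp_pos _).le)
    (hω.summable.mul_right _)

theorem integrable_pathCost {M : StorageModel} (hM : M.IsAdmissible) {μ : ℝ → ℝ → ℝ}
    (hμ : M.IsPolicy μ) {s : ℝ} (hs : s ∈ Icc 0 M.cap) :
    Integrable (M.pathCost μ s) M.pathLaw := by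
  refine ((integrable_tsum_exp_arrivalTime hM).mul_const (M.cost M.maxShock)).mono' ?_ ?_
  · refine aestronglyMeasurable_of_tendsto_ae Filter.atTop
      (f := fun n ω => ∑ k ∈ Finset.range n, Real.exp (-M.discount * arrivalTime ω k) *
        M.cost ((ω k).2 - μ (M.levelBefore μ s ω k) (ω k).2)) (fun n => ?_) ?_
    -- `cost` need not be measurable off `[0, B]`. The continuous `extCost` agrees with it on
    -- regular paths, which gives a.e. measurability of the partial sums.
    · have hm : Measurable fun ω : ℕ → ℝ × ℝ => ∑ k ∈ Finset.range n,
          Real.exp (-M.discount * arrivalTime ω k) *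
            M.extCost ((ω k).2 - μ (M.levelBefore μ s ω k) (ω k).2) := by
        refine Finset.measurable_fun_sum _ fun k _ => ?_
        refine Measurable.mul (by fun_prop) ((continuous_extCost hM).measurable.comp ?_)
        exact (measurable_pi_apply k).snd.sub (hμ.measurable.comp
          ((measurable_levelBefore hμ s k).prodMk (measurable_pi_apply k).snd))
      refine hm.aestronglyMeasurable.congr ?_
      filter_upwards [ae_isRegularPath hM] with ω hω
      refine Finset.sum_congr rfl fun k _ => ?_
      rw [extCost_of_mem (hμ.sub_mem (levelBefore_mem hM hμ hs hω k) (hω.shock_mem k)).2]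
    · filter_upwards [ae_isRegularPath hM] with ω hω
      exact (summable_pathCost hM hμ hs hω).hasSum.tendsto_sum_nat
  · filter_upwards [ae_isRegularPath hM] with ω hω
    have h := pathCost_mem hM hμ hs hω
    rw [Real.norm_of_nonneg h.1]
    exact h.2

theorem exists_expectedCost_bound {M : StorageModel} (hM : M.IsAdmissible) {μ : ℝ → ℝ → ℝ}
    (hμ : M.IsPolicy μ) : ∃ K, ∀ s ∈ Icc 0 M.cap, |M.expectedCost μ s| ≤ K := by
  refine ⟨∫ ω, (∑' k, Real.exp (-M.discount * arrivalTime ω k)) * M.cost M.maxShock ∂M.pathLaw,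
    fun s hs => ?_⟩
  rw [expectedCost_eq, ← Real.norm_eq_abs]
  refine norm_integral_le_of_norm_le ((integrable_tsum_exp_arrivalTime hM).mul_const _) ?_
  filter_upwards [ae_isRegularPath hM] with ω hω
  have h := pathCost_mem hM hμ hs hω
  rw [Real.norm_of_nonneg h.1]
  exact h.2

/-! ### The renewal equation -/

theorem pathCost_consPath {M : StorageModel} (hM : M.IsAdmissible) {μ : ℝ → ℝ → ℝ}
    (hμ : M.IsPolicy μ) {s : ℝ} (hs : s ∈ Icc 0 M.cap) {a : ℝ × ℝ} {ω : ℕ → ℝ × ℝ}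
    (ha : 0 < a.1 ∧ a.2 ∈ Icc 0 M.maxShock) (hω : M.IsRegularPath ω) :
    M.pathCost μ s (consPath (a, ω)) = Real.exp (-M.discount * a.1) *
      (M.cost (a.2 - μ (M.refill s a.1) a.2) +
        M.pathCost μ (M.refill s a.1 - μ (M.refill s a.1) a.2) ω) := by
  rw [pathCost, (summable_pathCost hM hμ hs (hω.consPath ha)).tsum_eq_zero_add, mul_add]
  congr 1
  · rw [arrivalTime_consPath_zero]
    rfl
  · rw [pathCost, ← tsum_mul_left]
    refine tsum_congr fun k => ?_
    rw [arrivalTime_consPath_succ, levelBefore_consPath_succ, mul_add, Real.exp_add, mul_assoc]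
    rfl

/-- Conditioning on the first shock. -/
theorem expectedCost_renewal {M : StorageModel} (hM : M.IsAdmissible) {μ : ℝ → ℝ → ℝ}
    (hμ : M.IsPolicy μ) {s : ℝ} (hs : s ∈ Icc 0 M.cap) :
    Integrable (fun a : ℝ × ℝ => Real.exp (-M.discount * a.1) *
      M.costAtShock μ (M.refill s a.1) a.2) M.stepLaw ∧
    M.expectedCost μ s = ∫ a, Real.exp (-M.discount * a.1) *
      M.costAtShock μ (M.refill s a.1) a.2 ∂M.stepLaw := by
  have := isProbabilityMeasure_stepLaw hM
  have := isProbabilityMeasure_pathLaw hM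
  have hi := integrable_pathCost hM hμ hs
  rw [← map_consPath hM] at hi
  have hi' := (integrable_map_measure hi.aestronglyMeasurable
    measurable_consPath.aemeasurable).1 hi
  have heq : (fun a => ∫ ω, M.pathCost μ s (consPath (a, ω)) ∂M.pathLaw) =ᵐ[M.stepLaw]
      fun a => Real.exp (-M.discount * a.1) * M.costAtShock μ (M.refill s a.1) a.2 := by
    filter_upwards [ae_stepLaw hM] with a ha
    have hmem := (hμ.sub_mem (refill_mem hM hs.1 ha.1.le) ha.2).1
    have : (fun ω => M.pathCost μ s (consPath (a, ω))) =ᵐ[M.pathLaw]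
        fun ω => Real.exp (-M.discount * a.1) *
          (M.cost (a.2 - μ (M.refill s a.1) a.2) +
            M.pathCost μ (M.refill s a.1 - μ (M.refill s a.1) a.2) ω) := by
      filter_upwards [ae_isRegularPath hM] with ω hω using pathCost_consPath hM hμ hs ha hω
    rw [integral_congr_ae this, integral_const_mul,
      integral_add (integrable_const _) (integrable_pathCost hM hμ hmem), costAtShock,
      expectedCost_eq]
    simp
  refine ⟨hi'.integral_prod_left.congr heq, ?_⟩
  rw [← integral_congr_ae heq, ← integral_prod (fun p => M.pathCost μ s (consPath p)) hi',
    expectedCost_eq, ← integral_map measurable_consPath.aemeasurable hi.aestronglyMeasurable,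
    map_consPath hM]

/-! ### The one-step minimization -/

/-- Cost of withdrawing `u` at a shock of size `w` that finds the level `s`, when `C` is the cost
of the future. -/
def withdrawCost (M : StorageModel) (C : ℝ → ℝ) (s w u : ℝ) : ℝ :=
  M.extCost (w - u) + C (s - u)

/-- Minimum of `withdrawCost` over the feasible withdrawals, which are parametrized by the
fraction of the largest one. -/
def minCost (M : StorageModel) (C : ℝ → ℝ) (s w : ℝ) : ℝ :=
  sInf ((fun t => M.withdrawCost C s w (t * min s w)) '' Icc 0 1)

theorem continuous_withdrawCost {M : StorageModel} (hM : M.IsAdmissible) {C : ℝ → ℝ}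
    (hC : Continuous C) {X : Type*} [TopologicalSpace X] {s w u : X → ℝ} (hs : Continuous s)
    (hw : Continuous w) (hu : Continuous u) :
    Continuous fun x => M.withdrawCost C (s x) (w x) (u x) :=
  ((continuous_extCost hM).comp (hw.sub hu)).add (hC.comp (hs.sub hu))

theorem exists_minCost_eq_fraction {M : StorageModel} (hM : M.IsAdmissible) {C : ℝ → ℝ}
    (hC : Continuous C) (s w : ℝ) :
    ∃ t ∈ Icc (0 : ℝ) 1, M.minCost C s w = M.withdrawCost C s w (t * min s w) :=
  isCompact_Icc.exists_sInf_image_eq ⟨0, by simp⟩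
    (continuous_withdrawCost hM hC continuous_const continuous_const (by fun_prop)).continuousOn

theorem minCost_le_fraction {M : StorageModel} (hM : M.IsAdmissible) {C : ℝ → ℝ}
    (hC : Continuous C) (s w : ℝ) {t : ℝ} (ht : t ∈ Icc (0 : ℝ) 1) :
    M.minCost C s w ≤ M.withdrawCost C s w (t * min s w) :=
  csInf_le (isCompact_Icc.image (continuous_withdrawCost hM hC continuous_const continuous_const
    (by fun_prop))).bddBelow (mem_image_of_mem _ ht)

theorem minCost_le {M : StorageModel} (hM : M.IsAdmissible) {C : ℝ → ℝ} (hC : Continuous C)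
    {s w u : ℝ} (hu : u ∈ Icc 0 (min s w)) : M.minCost C s w ≤ M.withdrawCost C s w u := by
  -- If the largest withdrawal is `0`, the quotient defining the fraction is replaced by the
  -- fraction `0`.
  rcases eq_or_lt_of_le (hu.1.trans hu.2) with h | h
  · have h0 : u = 0 := le_antisymm (h ▸ hu.2) hu.1
    have := minCost_le_fraction hM hC s w (t := 0) (by simp)
    rwa [zero_mul, ← h0] at this
  · have := minCost_le_fraction hM hC s w (t := u / min s w)
      ⟨div_nonneg hu.1 h.le, (div_le_one h).2 hu.2⟩
    rwa [div_mul_cancel₀ _ h.ne'] at this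

theorem exists_minCost_eq {M : StorageModel} (hM : M.IsAdmissible) {C : ℝ → ℝ}
    (hC : Continuous C) {s w : ℝ} (hs : 0 ≤ s) (hw : 0 ≤ w) :
    ∃ u ∈ Icc 0 (min s w), M.minCost C s w = M.withdrawCost C s w u := by
  obtain ⟨t, ht, h⟩ := exists_minCost_eq_fraction hM hC s w
  have hm : 0 ≤ min s w := le_min hs hw
  exact ⟨_, ⟨mul_nonneg ht.1 hm, mul_le_of_le_one_left hm ht.2⟩, h⟩

/-- Measuring withdrawals as fractions makes the minimization run over `[0, 1]` for all `(s, w)`,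
and a minimum over a fixed compact set of a jointly continuous function is continuous. -/
theorem continuous_minCost {M : StorageModel} (hM : M.IsAdmissible) {C : ℝ → ℝ}
    (hC : Continuous C) : Continuous fun p : ℝ × ℝ => M.minCost C p.1 p.2 := by
  refine isCompact_Icc.continuous_sInf
    (f := fun (p : ℝ × ℝ) t => M.withdrawCost C p.1 p.2 (t * min p.1 p.2)) ?_
  exact continuous_withdrawCost hM hC (by fun_prop) (by fun_prop) (by fun_prop)

/-- The fraction that is optimal for `D` is tried for `C`. No sign of `s` or `w` is needed, so the
Bellman operator can act on bounded continuous functions on all of `ℝ`. -/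
theorem minCost_le_add {M : StorageModel} (hM : M.IsAdmissible) {C D : ℝ → ℝ}
    (hC : Continuous C) (hD : Continuous D) {δ : ℝ} (h : ∀ x, C x ≤ D x + δ) (s w : ℝ) :
    M.minCost C s w ≤ M.minCost D s w + δ := by
  obtain ⟨t, ht, e⟩ := exists_minCost_eq_fraction hM hD s w
  have h1 := minCost_le_fraction hM hC s w ht
  have h2 := h (s - t * min s w)
  rw [e]
  unfold withdrawCost at *
  linarith

theorem abs_minCost_le {M : StorageModel} (hM : M.IsAdmissible) (C : ℝ →ᵇ ℝ) (s w : ℝ) :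
    |M.minCost C s w| ≤ M.cost M.maxShock + ‖C‖ := by
  obtain ⟨t, -, e⟩ := exists_minCost_eq_fraction hM C.continuous s w
  rw [e, withdrawCost]
  have h1 := extCost_mem hM (w - t * min s w)
  have h2 := C.norm_coe_le_norm (s - t * min s w)
  refine (abs_add_le _ _).trans (add_le_add ?_ h2)
  rw [abs_of_nonneg h1.1]
  exact h1.2

/-! ### The Bellman operator and its fixed point -/

/-- The expected discount factor at the first shock, as a real number. -/
def discountFactor (M : StorageModel) : ℝ :=
  ∫ a, Real.exp (-M.discount * a.1) ∂M.stepLaw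

theorem discountFactor_nonneg (M : StorageModel) : 0 ≤ M.discountFactor :=
  integral_nonneg fun _ => (Real.exp_pos _).le

theorem discountFactor_lt_one {M : StorageModel} (hM : M.IsAdmissible) : M.discountFactor < 1 := by
  rw [discountFactor, integral_eq_lintegral_of_nonneg_ae (ae_of_all _ fun a => (Real.exp_pos _).le)
    (Measurable.aestronglyMeasurable (by fun_prop))]
  have h := meanDiscount_lt_one hM
  rw [← ENNReal.toReal_one]
  exact ENNReal.toReal_strict_mono ENNReal.one_ne_top h

theorem integrable_discount_mul {M : StorageModel} (hM : M.IsAdmissible) {f : ℝ × ℝ → ℝ}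
    (hf : AEStronglyMeasurable f M.stepLaw) {K : ℝ} (hK : ∀ a, |f a| ≤ K) :
    Integrable (fun a => Real.exp (-M.discount * a.1) * f a) M.stepLaw := by
  have := isProbabilityMeasure_stepLaw hM
  refine (integrable_const K).mono'
    ((Measurable.aestronglyMeasurable (by fun_prop)).mul hf) ?_
  filter_upwards [ae_stepLaw hM] with a ha
  have h1 : Real.exp (-M.discount * a.1) ≤ 1 :=
    Real.exp_le_one_iff.2 (by nlinarith [mul_pos hM.discount_pos ha.1])
  rw [norm_mul, Real.norm_of_nonneg (Real.exp_pos _).le, Real.norm_eq_abs]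
  exact (mul_le_of_le_one_left (abs_nonneg _) h1).trans (hK a)

theorem integrable_discount {M : StorageModel} (hM : M.IsAdmissible) (c : ℝ) :
    Integrable (fun a : ℝ × ℝ => Real.exp (-M.discount * a.1) * c) M.stepLaw :=
  integrable_discount_mul hM aestronglyMeasurable_const (fun _ => le_rfl)

theorem measurable_minCost_refill {M : StorageModel} (hM : M.IsAdmissible) {C : ℝ → ℝ}
    (hC : Continuous C) (s : ℝ) :
    Measurable fun a : ℝ × ℝ => M.minCost C (M.refill s a.1) a.2 :=
  ((continuous_minCost hM hC).comp ((M.continuous_refill.comp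
    (continuous_const.prodMk continuous_fst)).prodMk continuous_snd)).measurable

theorem integrable_minCost {M : StorageModel} (hM : M.IsAdmissible) (C : ℝ →ᵇ ℝ) (s : ℝ) :
    Integrable (fun a : ℝ × ℝ => Real.exp (-M.discount * a.1) *
      M.minCost C (M.refill s a.1) a.2) M.stepLaw :=
  integrable_discount_mul hM (measurable_minCost_refill hM C.continuous s).aestronglyMeasurable
    fun _ => abs_minCost_le hM C _ _

/-- The Bellman operator of the model. -/
def bellman {M : StorageModel} (hM : M.IsAdmissible) (C : ℝ →ᵇ ℝ) : ℝ →ᵇ ℝ :=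
  BoundedContinuousFunction.ofNormedAddCommGroup
    (fun s => ∫ a, Real.exp (-M.discount * a.1) * M.minCost C (M.refill s a.1) a.2 ∂M.stepLaw)
    (by
      refine continuous_of_dominated
        (bound := fun a => Real.exp (-M.discount * a.1) * (M.cost M.maxShock + ‖C‖))
        (fun s => (integrable_minCost hM C s).aestronglyMeasurable)
        (fun s => ae_of_all _ fun a => ?_) (integrable_discount hM _) (ae_of_all _ fun a => ?_)
      · rw [norm_mul, Real.norm_of_nonneg (Real.exp_pos _).le]
        exact mul_le_mul_of_nonneg_left (abs_minCost_le hM C _ _) (Real.exp_pos _).le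
      · exact continuous_const.mul ((continuous_minCost hM C.continuous).comp
          ((M.continuous_refill.comp (continuous_id.prodMk continuous_const)).prodMk
            continuous_const)))
    (∫ a, Real.exp (-M.discount * a.1) * (M.cost M.maxShock + ‖C‖) ∂M.stepLaw)
    (fun s => norm_integral_le_of_norm_le (integrable_discount hM _) (ae_of_all _ fun a => by
      rw [norm_mul, Real.norm_of_nonneg (Real.exp_pos _).le]
      exact mul_le_mul_of_nonneg_left (abs_minCost_le hM C _ _) (Real.exp_pos _).le))

theorem bellman_apply {M : StorageModel} (hM : M.IsAdmissible) (C : ℝ →ᵇ ℝ) (s : ℝ) :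
    bellman hM C s =
      ∫ a, Real.exp (-M.discount * a.1) * M.minCost C (M.refill s a.1) a.2 ∂M.stepLaw := rfl

theorem bellman_le_add {M : StorageModel} (hM : M.IsAdmissible) (C D : ℝ →ᵇ ℝ) (s : ℝ) :
    bellman hM C s ≤ bellman hM D s + M.discountFactor * dist C D := by
  rw [bellman_apply, bellman_apply, discountFactor, ← integral_mul_const,
    ← integral_add (integrable_minCost hM D s) (integrable_discount hM _)]
  refine integral_mono (integrable_minCost hM C s)
    ((integrable_minCost hM D s).add (integrable_discount hM _)) fun a => ?_
  simp only [← mul_add]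
  refine mul_le_mul_of_nonneg_left (minCost_le_add hM C.continuous D.continuous (fun x => ?_) _ _)
    (Real.exp_pos _).le
  have := (abs_le.1 (Real.dist_eq _ _ ▸ BoundedContinuousFunction.dist_coe_le_dist (f := C)
    (g := D) x)).2
  linarith

theorem contractingWith_bellman {M : StorageModel} (hM : M.IsAdmissible) :
    ContractingWith ⟨M.discountFactor, M.discountFactor_nonneg⟩ (bellman hM) := by
  refine ⟨discountFactor_lt_one hM, LipschitzWith.of_dist_le_mul fun C D => ?_⟩
  refine (BoundedContinuousFunction.dist_le
    (mul_nonneg M.discountFactor_nonneg dist_nonneg)).2 fun s => ?_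
  rw [Real.dist_eq, abs_le]
  have h1 := bellman_le_add hM C D s
  have h2 := bellman_le_add hM D C s
  rw [dist_comm] at h2
  change -(M.discountFactor * dist C D) ≤ _ ∧ _ ≤ M.discountFactor * dist C D
  constructor <;> linarith

/-- The value function: the fixed point of the Bellman operator. -/
def value {M : StorageModel} (hM : M.IsAdmissible) : ℝ →ᵇ ℝ :=
  ContractingWith.fixedPoint (bellman hM) (contractingWith_bellman hM)

theorem value_eq {M : StorageModel} (hM : M.IsAdmissible) (s : ℝ) :
    value hM s = ∫ a, Real.exp (-M.discount * a.1) *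
      M.minCost (value hM) (M.refill s a.1) a.2 ∂M.stepLaw := by
  rw [← bellman_apply hM]
  exact (DFunLike.congr_fun (contractingWith_bellman hM).fixedPoint_isFixedPt s).symm

/-! ### Monotonicity and convexity of the value function -/

theorem minCost_antitone {M : StorageModel} (hM : M.IsAdmissible) {C : ℝ → ℝ}
    (hC : Continuous C) (hanti : AntitoneOn C (Icc 0 M.cap)) {w : ℝ}
    (hw : w ∈ Icc 0 M.maxShock) : AntitoneOn (fun s => M.minCost C s w) (Icc 0 M.cap) := by
  intro s hs s' hs' hss
  -- A withdrawal that is optimal at `s` stays feasible at the higher level `s'`.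
  obtain ⟨u, hu, e⟩ := exists_minCost_eq hM hC hs.1 hw.1
  have hus := hu.2.trans (min_le_left _ _)
  have h := minCost_le hM hC (s := s') (w := w) ⟨hu.1, hu.2.trans (min_le_min_right _ hss)⟩
  have h2 := hanti (a := s - u) (b := s' - u) ⟨by linarith, by linarith [hu.1, hs.2]⟩
    ⟨by linarith, by linarith [hu.1, hs'.2]⟩ (by linarith)
  simp only [e]
  unfold withdrawCost at *
  linarith

theorem strictConvexOn_extCost {M : StorageModel} (hconv : StrictConvexOn ℝ (Icc 0 M.maxShock) M.cost) :
    StrictConvexOn ℝ (Icc 0 M.maxShock) M.extCost :=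
  hconv.congr fun _ hx => (extCost_of_mem hx).symm

/-- The cost is jointly convex in level and withdrawal, and the feasible pairs form a convex set, so
partial minimization keeps convexity. -/
theorem minCost_convexOn {M : StorageModel} (hM : M.IsAdmissible)
    (hconv : StrictConvexOn ℝ (Icc 0 M.maxShock) M.cost) {C : ℝ → ℝ}
    (hC : Continuous C) (hCconv : ConvexOn ℝ (Icc 0 M.cap) C) {w : ℝ}
    (hw : w ∈ Icc 0 M.maxShock) : ConvexOn ℝ (Icc 0 M.cap) (fun s => M.minCost C s w) := by
  refine ⟨convex_Icc _ _, fun s hs s' hs' a b ha hb hab => ?_⟩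
  obtain ⟨u, hu, e⟩ := exists_minCost_eq hM hC hs.1 hw.1
  obtain ⟨u', hu', e'⟩ := exists_minCost_eq hM hC hs'.1 hw.1
  have h1 := hu.2.trans (min_le_left _ _)
  have h2 := hu.2.trans (min_le_right _ _)
  have h1' := hu'.2.trans (min_le_left _ _)
  have h2' := hu'.2.trans (min_le_right _ _)
  have hb1 : b = 1 - a := by linarith
  have hle := minCost_le hM hC (s := a • s + b • s') (w := w) (u := a * u + b * u') (by
    simp only [smul_eq_mul]
    refine ⟨add_nonneg (mul_nonneg ha hu.1) (mul_nonneg hb hu'.1), le_min ?_ ?_⟩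
    · exact add_le_add (mul_le_mul_of_nonneg_left h1 ha) (mul_le_mul_of_nonneg_left h1' hb)
    · calc a * u + b * u' ≤ a * w + b * w :=
          add_le_add (mul_le_mul_of_nonneg_left h2 ha) (mul_le_mul_of_nonneg_left h2' hb)
        _ = w := by rw [← add_mul, hab, one_mul])
  have c1 := (strictConvexOn_extCost hconv).convexOn.2 (x := w - u) (y := w - u')
    ⟨by linarith, by linarith [hu.1, hw.2]⟩ ⟨by linarith, by linarith [hu'.1, hw.2]⟩ ha hb hab
  have c2 := hCconv.2 (x := s - u) (y := s' - u')
    ⟨by linarith, by linarith [hu.1, hs.2]⟩ ⟨by linarith, by linarith [hu'.1, hs'.2]⟩ ha hb hab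
  simp only [e, e']
  refine hle.trans ?_
  simp only [withdrawCost, smul_eq_mul] at *
  rw [show w - (a * u + b * u') = a * (w - u) + b * (w - u') by rw [hb1]; ring,
    show a * s + b * s' - (a * u + b * u') = a * (s - u) + b * (s' - u') by ring]
  linarith

theorem refill_mono (M : StorageModel) {s s' : ℝ} (h : s ≤ s') (t : ℝ) :
    M.refill s t ≤ M.refill s' t :=
  min_le_min_right _ (by linarith)

theorem refill_concave (M : StorageModel) {s s' a b : ℝ} (ha : 0 ≤ a) (hb : 0 ≤ b)
    (hab : a + b = 1) (t : ℝ) :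
    a * M.refill s t + b * M.refill s' t ≤ M.refill (a * s + b * s') t := by
  have h1 := mul_le_mul_of_nonneg_left (min_le_left (s + M.ramp * t) M.cap) ha
  have h2 := mul_le_mul_of_nonneg_left (min_le_right (s + M.ramp * t) M.cap) ha
  have h3 := mul_le_mul_of_nonneg_left (min_le_left (s' + M.ramp * t) M.cap) hb
  have h4 := mul_le_mul_of_nonneg_left (min_le_right (s' + M.ramp * t) M.cap) hb
  have hb1 : b = 1 - a := by linarith
  refine le_min ((add_le_add h1 h3).trans_eq ?_) ((add_le_add h2 h4).trans_eq ?_)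
  · rw [hb1]; ring
  · rw [hb1]; ring

theorem bellman_antitone {M : StorageModel} (hM : M.IsAdmissible) {C : ℝ →ᵇ ℝ}
    (hanti : AntitoneOn C (Icc 0 M.cap)) : AntitoneOn (bellman hM C) (Icc 0 M.cap) := by
  intro s hs s' hs' hss
  rw [bellman_apply, bellman_apply]
  refine integral_mono_ae (integrable_minCost hM C _) (integrable_minCost hM C _) ?_
  filter_upwards [ae_stepLaw hM] with a ha
  exact mul_le_mul_of_nonneg_left (minCost_antitone hM C.continuous hanti ha.2
    (refill_mem hM hs.1 ha.1.le) (refill_mem hM hs'.1 ha.1.le) (M.refill_mono hss _))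
    (Real.exp_pos _).le

/-- A convex antitone function composed with the concave `refill` is convex. This is why
antitonicity has to be carried along with convexity. -/
theorem bellman_convexOn {M : StorageModel} (hM : M.IsAdmissible)
    (hconv : StrictConvexOn ℝ (Icc 0 M.maxShock) M.cost) {C : ℝ →ᵇ ℝ}
    (hanti : AntitoneOn C (Icc 0 M.cap)) (hCconv : ConvexOn ℝ (Icc 0 M.cap) C) :
    ConvexOn ℝ (Icc 0 M.cap) (bellman hM C) := by
  refine ⟨convex_Icc _ _, fun s hs s' hs' a b ha hb hab => ?_⟩
  simp only [bellman_apply, smul_eq_mul]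
  rw [← integral_const_mul, ← integral_const_mul, ← integral_add
    ((integrable_minCost hM C _).const_mul _) ((integrable_minCost hM C _).const_mul _)]
  refine integral_mono_ae (integrable_minCost hM C _) (((integrable_minCost hM C _).const_mul
    _).add ((integrable_minCost hM C _).const_mul _)) ?_
  filter_upwards [ae_stepLaw hM] with p hp
  have hr := refill_mem hM hs.1 hp.1.le
  have hr' := refill_mem hM hs'.1 hp.1.le
  have h1 := (minCost_convexOn hM hconv C.continuous hCconv hp.2).2 hr hr' ha hb hab
  have h2 := minCost_antitone hM C.continuous hanti hp.2
    (convex_Icc _ _ hr hr' ha hb hab)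
    (refill_mem hM (convex_Icc _ _ hs hs' ha hb hab).1 hp.1.le)
    (M.refill_concave ha hb hab p.1)
  simp only [smul_eq_mul] at h1 h2
  have h3 := mul_le_mul_of_nonneg_left (h2.trans h1) (Real.exp_pos (-M.discount * p.1)).le
  refine h3.trans_eq ?_
  ring

theorem value_antitone_convexOn {M : StorageModel} (hM : M.IsAdmissible)
    (hconv : StrictConvexOn ℝ (Icc 0 M.maxShock) M.cost) :
    AntitoneOn (value hM) (Icc 0 M.cap) ∧ ConvexOn ℝ (Icc 0 M.cap) (value hM) := by
  -- Both properties hold for `0`, are kept by each iteration, and pass to the pointwise limit.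
  have hiter : ∀ n, AntitoneOn ((bellman hM)^[n] 0) (Icc 0 M.cap) ∧
      ConvexOn ℝ (Icc 0 M.cap) ((bellman hM)^[n] 0) := by
    intro n
    induction n with
    | zero => exact ⟨fun _ _ _ _ _ => le_rfl, convexOn_const 0 (convex_Icc _ _)⟩
    | succ n ih =>
      rw [Function.iterate_succ_apply']
      exact ⟨bellman_antitone hM ih.1, bellman_convexOn hM hconv ih.1 ih.2⟩
  have hlim : ∀ s, Filter.Tendsto (fun n => (bellman hM)^[n] 0 s) Filter.atTop
      (nhds (value hM s)) := fun s =>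
    ((BoundedContinuousFunction.lipschitz_eval_const s).continuous.tendsto _).comp
      ((contractingWith_bellman hM).tendsto_iterate_fixedPoint 0)
  refine ⟨fun s hs s' hs' h => le_of_tendsto_of_tendsto' (hlim _) (hlim _)
    fun n => (hiter n).1 hs hs' h, convex_Icc _ _, fun s hs s' hs' a b ha hb hab => ?_⟩
  exact le_of_tendsto_of_tendsto' (hlim _) (((hlim s).const_smul a).add ((hlim s').const_smul b))
    fun n => (hiter n).2.2 hs hs' ha hb hab

/-! ### Uniqueness of the minimizer and the greedy policy -/

theorem minimizer_unique {M : StorageModel} (hM : M.IsAdmissible)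
    (hconv : StrictConvexOn ℝ (Icc 0 M.maxShock) M.cost) {C : ℝ → ℝ}
    (hC : Continuous C) (hCconv : ConvexOn ℝ (Icc 0 M.cap) C) {s w : ℝ}
    (hs : s ∈ Icc 0 M.cap) (hw : w ∈ Icc 0 M.maxShock) {u v : ℝ}
    (hu : u ∈ Icc 0 (min s w)) (hv : v ∈ Icc 0 (min s w))
    (hum : M.withdrawCost C s w u ≤ M.minCost C s w)
    (hvm : M.withdrawCost C s w v ≤ M.minCost C s w) : u = v := by
  by_contra hne
  have h1 := hu.2.trans (min_le_left _ _)
  have h2 := hu.2.trans (min_le_right _ _)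
  have h1' := hv.2.trans (min_le_left _ _)
  have h2' := hv.2.trans (min_le_right _ _)
  -- The midpoint of two distinct minimizers would be strictly cheaper: the stage cost gains
  -- strictly, while `C` contributes plain convexity.
  have hm := minCost_le hM hC (s := s) (w := w) (u := (u + v) / 2)
    ⟨by linarith [hu.1, hv.1], by linarith [hu.2, hv.2]⟩
  have mu : w - u ∈ Icc 0 M.maxShock := ⟨by linarith, by linarith [hu.1, hw.2]⟩
  have mv : w - v ∈ Icc 0 M.maxShock := ⟨by linarith, by linarith [hv.1, hw.2]⟩
  have hne' : w - u ≠ w - v := fun h => hne (by linarith)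
  have hhalf : (0 : ℝ) < 1 / 2 := by norm_num
  have c1 := (strictConvexOn_extCost hconv).2 mu mv hne' hhalf hhalf (by norm_num)
  have nu : s - u ∈ Icc 0 M.cap := ⟨by linarith, by linarith [hu.1, hs.2]⟩
  have nv : s - v ∈ Icc 0 M.cap := ⟨by linarith, by linarith [hv.1, hs.2]⟩
  have c2 := hCconv.2 nu nv hhalf.le hhalf.le (by norm_num)
  simp only [smul_eq_mul, withdrawCost] at *
  rw [show 1 / 2 * (w - u) + 1 / 2 * (w - v) = w - (u + v) / 2 by ring] at c1
  rw [show 1 / 2 * (s - u) + 1 / 2 * (s - v) = s - (u + v) / 2 by ring] at c2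
  linarith

/-- Minimizing withdrawals form a policy. -/
theorem exists_greedy_policy {M : StorageModel} (hM : M.IsAdmissible)
    (hconv : StrictConvexOn ℝ (Icc 0 M.maxShock) M.cost) {C : ℝ → ℝ}
    (hC : Continuous C) (hCconv : ConvexOn ℝ (Icc 0 M.cap) C) :
    ∃ ν, M.IsPolicy ν ∧ ∀ s ∈ Icc 0 M.cap, ∀ w ∈ Icc 0 M.maxShock,
      M.withdrawCost C s w (ν s w) = M.minCost C s w := by
  have hex : ∀ q : Icc 0 M.cap × Icc 0 M.maxShock, ∃ u : Icc 0 M.cap,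
      (u : ℝ) ≤ min (q.1 : ℝ) q.2 ∧ M.withdrawCost C q.1 q.2 u ≤ M.minCost C q.1 q.2 := by
    rintro ⟨s, w⟩
    obtain ⟨u, hu, e⟩ := exists_minCost_eq hM hC s.2.1 w.2.1
    exact ⟨⟨u, hu.1, (hu.2.trans (min_le_left _ _)).trans s.2.2⟩, hu.2, e.ge⟩
  choose f hf1 hf2 using hex
  have hcont : Continuous f := by
    rw [continuous_iff_isClosed]
    intro F hF
    set Γ : Set ((Icc 0 M.cap × Icc 0 M.maxShock) × Icc 0 M.cap) :=
      {p | (p.2 : ℝ) ≤ min (p.1.1 : ℝ) p.1.2 ∧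
        M.withdrawCost C p.1.1 p.1.2 p.2 ≤ M.minCost C p.1.1 p.1.2}
    have hΓc : IsClosed Γ := by
      have hc : Continuous fun p : (Icc 0 M.cap × Icc 0 M.maxShock) × Icc 0 M.cap =>
          min (p.1.1 : ℝ) p.1.2 := by fun_prop
      refine (isClosed_le (continuous_subtype_val.comp continuous_snd) hc).and
        (isClosed_le ?_ ?_)
      · exact continuous_withdrawCost hM hC (by fun_prop) (by fun_prop) (by fun_prop)
      · exact (continuous_minCost hM hC).comp (g := fun p : ℝ × ℝ => M.minCost C p.1 p.2)
          (f := fun p : (Icc 0 M.cap × Icc 0 M.maxShock) × Icc 0 M.cap =>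
            ((p.1.1 : ℝ), (p.1.2 : ℝ))) (by fun_prop)
    -- By uniqueness `Γ` is exactly the graph of `f`, so preimages of closed sets are projections of
    -- closed sets along a compact factor.
    have himg : f ⁻¹' F = Prod.fst '' (Γ ∩ Prod.snd ⁻¹' F) := by
      ext q
      constructor
      · exact fun hq => ⟨(q, f q), ⟨⟨hf1 q, hf2 q⟩, hq⟩, rfl⟩
      · rintro ⟨⟨q', u⟩, ⟨hu, huF⟩, rfl⟩
        have : f q' = u := Subtype.ext (minimizer_unique hM hconv hC hCconv q'.1.2 q'.2.2
          ⟨(f q').2.1, hf1 q'⟩ ⟨u.2.1, hu.1⟩ (hf2 q') hu.2)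
        rw [mem_preimage, this]
        exact huF
    rw [himg]
    exact isClosedMap_fst_of_compactSpace _ (hΓc.inter (hF.preimage continuous_snd))
  have hB := maxShock_nonneg hM
  -- Projecting onto the rectangle extends `f` continuously to the plane, so the policy is
  -- measurable everywhere.
  refine ⟨fun s w => f (projIcc 0 M.cap hM.cap_nonneg s, projIcc 0 M.maxShock hB w),
    ⟨?_, fun s hs w hw => ?_⟩, fun s hs w hw => ?_⟩
  · refine (continuous_subtype_val.comp (hcont.comp ?_)).measurable
    exact (continuous_projIcc.comp continuous_fst).prodMk
      (continuous_projIcc.comp continuous_snd)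
  · rw [projIcc_of_mem _ hs, projIcc_of_mem _ hw]
    exact ⟨(f _).2.1, hf1 _⟩
  · beta_reduce
    rw [projIcc_of_mem _ hs, projIcc_of_mem _ hw]
    exact le_antisymm (hf2 (⟨s, hs⟩, ⟨w, hw⟩))
      (minCost_le hM hC ⟨(f _).2.1, hf1 (⟨s, hs⟩, ⟨w, hw⟩)⟩)

/-! ### Comparison of the value function with the costs of policies -/

/-- Iterating improves the bound `K` to `discountFactor ^ n * K`, which tends to `0`. The
contraction principle itself does not apply to expected costs, whose continuity in the level is not
known. -/
theorem nonpos_of_le_discountFactor_mul {M : StorageModel} (hM : M.IsAdmissible) {h : ℝ → ℝ}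
    {I : Set ℝ} {K : ℝ} (hK : ∀ s ∈ I, h s ≤ K)
    (hstep : ∀ d, (∀ s ∈ I, h s ≤ d) → ∀ s ∈ I, h s ≤ M.discountFactor * d) :
    ∀ s ∈ I, h s ≤ 0 := by
  intro s hs
  have hn : ∀ n : ℕ, ∀ s ∈ I, h s ≤ M.discountFactor ^ n * K := by
    intro n
    induction n with
    | zero => simpa using hK
    | succ n ih =>
      rw [pow_succ', mul_assoc]
      exact hstep _ ih
  have hl := (tendsto_pow_atTop_nhds_zero_of_lt_one M.discountFactor_nonneg
    (discountFactor_lt_one hM)).mul_const K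
  rw [zero_mul] at hl
  exact ge_of_tendsto' hl fun n => hn n s hs

/-- Subtracting the renewal equation from the fixed-point equation bounds the difference by the
discounted difference after the first shock, since the withdrawal of `ν` is one candidate in the
minimum. -/
theorem value_le_expectedCost {M : StorageModel} (hM : M.IsAdmissible) {ν : ℝ → ℝ → ℝ}
    (hν : M.IsPolicy ν) : ∀ s ∈ Icc 0 M.cap, value hM s ≤ M.expectedCost ν s := by
  obtain ⟨K, hK⟩ := exists_expectedCost_bound hM hν
  have := nonpos_of_le_discountFactor_mul hM (I := Icc 0 M.cap)
    (h := fun s => value hM s - M.expectedCost ν s) (K := ‖value hM‖ + K)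
    (fun s hs => by
      have h1 := (abs_le.1 ((value hM).norm_coe_le_norm s)).2
      have h2 := (abs_le.1 (hK s hs)).1
      linarith)
    (fun d hd s hs => by
      obtain ⟨hi, he⟩ := expectedCost_renewal hM hν hs
      rw [he, sub_le_iff_le_add, value_eq, discountFactor, ← integral_mul_const,
        ← integral_add (integrable_discount hM d) hi]
      refine integral_mono_ae (integrable_minCost hM _ s) ((integrable_discount hM d).add hi) ?_
      filter_upwards [ae_stepLaw hM] with a ha
      simp only [← mul_add]
      refine mul_le_mul_of_nonneg_left ?_ (Real.exp_pos _).le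
      have hX := refill_mem hM hs.1 ha.1.le
      have hm := minCost_le hM (value hM).continuous (hν.mem_Icc _ hX _ ha.2)
      have hd' := hd _ (hν.sub_mem hX ha.2).1
      rw [withdrawCost, extCost_of_mem (hν.sub_mem hX ha.2).2] at hm
      unfold costAtShock
      linarith)
  exact fun s hs => sub_nonpos.1 (this s hs)

/-- The same subtraction with the sign reversed; it works because the greedy withdrawal attains the
minimum. -/
theorem expectedCost_le_value {M : StorageModel} (hM : M.IsAdmissible) {ν : ℝ → ℝ → ℝ}
    (hν : M.IsPolicy ν) (hgreedy : ∀ s ∈ Icc 0 M.cap, ∀ w ∈ Icc 0 M.maxShock,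
      M.withdrawCost (value hM) s w (ν s w) = M.minCost (value hM) s w) :
    ∀ s ∈ Icc 0 M.cap, M.expectedCost ν s ≤ value hM s := by
  obtain ⟨K, hK⟩ := exists_expectedCost_bound hM hν
  have := nonpos_of_le_discountFactor_mul hM (I := Icc 0 M.cap)
    (h := fun s => M.expectedCost ν s - value hM s) (K := ‖value hM‖ + K)
    (fun s hs => by
      have h1 := (abs_le.1 ((value hM).norm_coe_le_norm s)).1
      have h2 := (abs_le.1 (hK s hs)).2
      linarith)
    (fun d hd s hs => by
      obtain ⟨hi, he⟩ := expectedCost_renewal hM hν hs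
      rw [he, sub_le_iff_le_add, value_eq, discountFactor, ← integral_mul_const,
        ← integral_add (integrable_discount hM d) (integrable_minCost hM _ s)]
      refine integral_mono_ae hi ((integrable_discount hM d).add (integrable_minCost hM _ s)) ?_
      filter_upwards [ae_stepLaw hM] with a ha
      simp only [← mul_add]
      refine mul_le_mul_of_nonneg_left ?_ (Real.exp_pos _).le
      have hX := refill_mem hM hs.1 ha.1.le
      have hm := hgreedy _ hX _ ha.2
      have hd' := hd _ (hν.sub_mem hX ha.2).1
      rw [withdrawCost, extCost_of_mem (hν.sub_mem hX ha.2).2] at hm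
      unfold costAtShock
      linarith)
  exact fun s hs => sub_nonpos.1 (this s hs)

/-- With `ν` greedy, the chain is `g (w - μ) + V (s - μ) ≤ J_μ ≤ J_ν ≤ g (w - ν) + V (s - ν)`, all
at `(s, w)`. -/
theorem IsOptimalPolicy.withdrawCost_le {M : StorageModel} (hM : M.IsAdmissible)
    (hconv : StrictConvexOn ℝ (Icc 0 M.maxShock) M.cost) {μ : ℝ → ℝ → ℝ}
    (hμ : M.IsOptimalPolicy μ) {s w : ℝ} (hs : s ∈ Icc 0 M.cap) (hw : w ∈ Icc 0 M.maxShock) :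
    M.withdrawCost (value hM) s w (μ s w) ≤ M.minCost (value hM) s w := by
  obtain ⟨ν, hν, hg⟩ := exists_greedy_policy hM hconv (value hM).continuous
    (value_antitone_convexOn hM hconv).2
  have h1 := hμ.costAtShock_le ν hν s hs w hw
  have m1 := hμ.isPolicy.sub_mem hs hw
  have m2 := hν.sub_mem hs hw
  have h2 := value_le_expectedCost hM hμ.isPolicy _ m1.1
  have h3 := expectedCost_le_value hM hν hg _ m2.1
  rw [← hg s hs w hw, withdrawCost, withdrawCost, extCost_of_mem m1.2, extCost_of_mem m2.2]
  unfold costAtShock at h1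
  linarith

/-! ### The exchange argument -/

theorem IsOptimalPolicy.monotoneOn_level {M : StorageModel} (hM : M.IsAdmissible)
    (hconv : StrictConvexOn ℝ (Icc 0 M.maxShock) M.cost) {μ : ℝ → ℝ → ℝ}
    (hμ : M.IsOptimalPolicy μ) {w : ℝ} (hw : w ∈ Icc 0 M.maxShock) :
    MonotoneOn (fun s => μ s w) (Icc 0 M.cap) := by
  intro s hs s' hs' hss
  by_contra! hlt
  have hC := (value hM).continuous
  have hCconv := (value_antitone_convexOn hM hconv).2
  have hu := hμ.isPolicy.mem_Icc s hs w hw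
  have hu' := hμ.isPolicy.mem_Icc s' hs' w hw
  have h1 := minCost_le hM hC ⟨hu.1, hu.2.trans (min_le_min_right w hss)⟩
  have h2 := hμ.withdrawCost_le hM hconv hs' hw
  have h3 := hμ.withdrawCost_le hM hconv hs hw
  -- The stage costs are the same before and after the swap of the two withdrawals, so only the
  -- future costs need to be compared.
  have h4 := hCconv.add_le_add_of_add_eq (x := s - μ s w) (y := s - μ s' w) (z := s' - μ s w)
    (v := s' - μ s' w) (hμ.isPolicy.sub_mem hs hw).1 (hμ.isPolicy.sub_mem hs' hw).1
    (by linarith) (by linarith) (by ring)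
  refine hlt.ne (minimizer_unique hM hconv hC hCconv hs hw ⟨hu'.1, hlt.le.trans hu.2⟩ hu ?_ h3)
  unfold withdrawCost at *
  linarith

theorem IsOptimalPolicy.monotoneOn_shock {M : StorageModel} (hM : M.IsAdmissible)
    (hconv : StrictConvexOn ℝ (Icc 0 M.maxShock) M.cost) {μ : ℝ → ℝ → ℝ}
    (hμ : M.IsOptimalPolicy μ) {s : ℝ} (hs : s ∈ Icc 0 M.cap) :
    MonotoneOn (fun w => μ s w) (Icc 0 M.maxShock) := by
  intro w hw w' hw' hww
  by_contra! hlt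
  have hC := (value hM).continuous
  have hCconv := (value_antitone_convexOn hM hconv).2
  have hu := hμ.isPolicy.mem_Icc s hs w hw
  have hu' := hμ.isPolicy.mem_Icc s hs w' hw'
  have h1 := minCost_le hM hC ⟨hu.1, hu.2.trans (min_le_min_left s hww)⟩
  have h2 := hμ.withdrawCost_le hM hconv hs hw'
  have h3 := hμ.withdrawCost_le hM hconv hs hw
  -- Here the swap leaves the future costs unchanged, and the stage costs are compared.
  have h4 := (strictConvexOn_extCost hconv).convexOn.add_le_add_of_add_eq (x := w - μ s w)
    (y := w - μ s w') (z := w' - μ s w) (v := w' - μ s w') (hμ.isPolicy.sub_mem hs hw).2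
    (hμ.isPolicy.sub_mem hs hw').2 (by linarith) (by linarith) (by ring)
  refine hlt.ne (minimizer_unique hM hconv hC hCconv hs hw ⟨hu'.1, hlt.le.trans hu.2⟩ hu ?_ h3)
  unfold withdrawCost at *
  linarith

end StorageModel

end

theorem theorem4 (M : StorageModel) (hM : M.IsAdmissible)
    (hconv : StrictConvexOn ℝ (Set.Icc 0 M.maxShock) M.cost)
    (hdrift : M.PositiveDrift)
    (μ : ℝ → ℝ → ℝ) (hμ : M.IsOptimalPolicy μ) :
    (∀ w ∈ Set.Icc 0 M.maxShock, MonotoneOn (fun s => μ s w) (Set.Icc 0 M.cap)) ∧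
      (∀ s ∈ Set.Icc 0 M.cap, MonotoneOn (fun w => μ s w) (Set.Icc 0 M.maxShock)) := by
  exact ⟨fun _ hw => hμ.monotoneOn_level hM hconv hw, fun _ hs => hμ.monotoneOn_shock hM hconv hs⟩
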